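/- A half-plane is a set of the form $\{x\in\mathbb{R}^2 : \langle a,x\rangle\ge b\}$ (closed) or $\{x\in\mathbb{R}^2 : \langle a,x\rangle> b\}$ (open) with $a\in\mathbb{R}^2\setminus\{0\}$ and $b\in\mathbb{R}$. For an integer $k\ge 1$, let $\bar f_{\mathcal H}(k)$ denote the minimum number $m$ such that every finite set $H$ of half-planes admits a $k$-coloring $\chi:H\to\{1,\dots,k\}$ with the following property: for every point $p\in\mathbb{R}^2$ that is contained in at least $m$ half-planes of $H$ and every color $i\in\{1,\dots,k\}$, some half-plane of $H$ of color $i$ contains $p$ (with $\bar f_{\mathcal H}(k)=\infty$ if there is no such $m$). Theorem. For every integer $k\ge 1$, $\bar f_{\mathcal H}(k)\le 3k-2$. Equivalently, every finite set of half-planes can be $k$-colored so that any point covered by at least $3k-2$ of them is covered by a half-plane of every color. -/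

import Mathlib

/-- The Euclidean plane. -/
abbrev Plane : Type := EuclideanSpace ℝ (Fin 2)

/-- A (closed or open) half-plane: one of the two sides of a line, with or without the line. -/
def IsHalfPlane (h : Set Plane) : Prop :=
  ∃ (a : Plane) (b : ℝ), a ≠ 0 ∧ (h = {x | b ≤ inner ℝ a x} ∨ h = {x | b < inner ℝ a x})

/-- The family of all half-planes. -/
def halfPlanes : Set (Set Plane) := {h | IsHalfPlane h}

/-- A set of vertices is polychromatic for a `k`-coloring if it meets every color class. -/
def IsPolychromatic {V : Type*} {k : ℕ} (χ : V → Fin k) (S : Set V) : Prop :=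
  ∀ i : Fin k, (S ∩ χ ⁻¹' {i}).Nonempty

/-- The members of the finite family `F` that contain the point `p`. -/
def coveringAt {X : Type*} (F : Finset (Set X)) (p : X) : Set ↥F :=
  {R | p ∈ (R : Set X)}

/-- Every finite sub-family of `𝓡` has a `k`-coloring for which, at each point contained in at
least `m` of its members, the members containing that point are polychromatic. -/
def IsCoverThreshold {X : Type*} (𝓡 : Set (Set X)) (k m : ℕ) : Prop :=
  ∀ F : Finset (Set X), (F : Set (Set X)) ⊆ 𝓡 →
    ∃ χ : ↥F → Fin k, ∀ p : X,
      m ≤ (coveringAt F p).ncard → IsPolychromatic χ (coveringAt F p)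

/-- The least `m` such that `IsCoverThreshold 𝓡 k m`, which is `⊤` when there is none. -/
noncomputable def fBar {X : Type*} (𝓡 : Set (Set X)) (k : ℕ) : ℕ∞ :=
  ⨅ m ∈ {m : ℕ | IsCoverThreshold 𝓡 k m}, (m : ℕ∞)

/-- The bound `fBar 𝓡 k ≤ m` says exactly that `m` itself has the defining property. -/
theorem fBar_le_iff {X : Type*} (𝓡 : Set (Set X)) (k m : ℕ) :
    fBar 𝓡 k ≤ (m : ℕ∞) ↔ IsCoverThreshold 𝓡 k m := by
  constructor
  · intro h
    have h1 : fBar 𝓡 k < ((m + 1 : ℕ) : ℕ∞) :=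
      lt_of_le_of_lt h (by exact_mod_cast Nat.lt_succ_self m)
    simp only [fBar, iInf_lt_iff] at h1
    obtain ⟨n, hn, hlt⟩ := h1
    have hnm : n ≤ m := Nat.lt_succ_iff.mp (by exact_mod_cast hlt)
    intro F hF
    obtain ⟨χ, hχ⟩ := hn F hF
    exact ⟨χ, fun p hp => hχ p (hnm.trans hp)⟩
  · intro h
    exact iInf₂_le (f := fun (n : ℕ) (_ : n ∈ {n : ℕ | IsCoverThreshold 𝓡 k n}) => (n : ℕ∞)) m h

/-! Duality turns the half-plane with data (a, b) into the vector (a, -b) of a three-dimensional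
space and a point p into the functional `affineEval p`, whose positive side should hold exactly the
half-planes containing p. Finitely many half-planes have finitely many covering patterns, so the
vectors can be perturbed into general position without changing any pattern.

It remains to color vectors so that every half-space with many of them sees all colors. One color
class is a set S hitting every half-space with at least m vectors, such that each of these contains
a half-space that still has m vectors but at most three of S (`exists_isShallowHittingSet`).
Removing S costs one color and at most three vectors, so induction gives 3(k - 1) + 1 = 3k - 2.

If 0 lies in the convex hull of the vectors, S consists of the vertices of a tetrahedron around 0.
Otherwise S is a minimal hitting set of extreme vectors, and `exists_forall_nonpos_of_extreme` keeps
three of them from sharing a half-space with exactly m vectors. -/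

/-! ### General position -/

/-- A proper subspace is closed with empty interior, so removing it leaves a nonempty open set. -/
theorem exists_mem_open_forall_notMem_submodule {E J : Type*} [NormedAddCommGroup E]
    [NormedSpace ℝ E] [FiniteDimensional ℝ E] (s : Finset J) (W : J → Submodule ℝ E)
    (hW : ∀ j ∈ s, W j ≠ ⊤) {U : Set E} (hU : IsOpen U) (hne : U.Nonempty) :
    ∃ x ∈ U, ∀ j ∈ s, x ∉ W j := by
  classical
  induction s using Finset.induction_on generalizing U with
  | empty => exact ⟨hne.some, hne.some_mem, by simp⟩
  | insert j s hj ih =>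
    have hopen : IsOpen (U \ (W j : Set E)) := hU.sdiff (W j).closed_of_finiteDimensional
    have hne' : (U \ (W j : Set E)).Nonempty := by
      by_contra hemp
      have hsub : U ⊆ (W j : Set E) := Set.sdiff_eq_empty.mp (Set.not_nonempty_iff_eq_empty.mp hemp)
      exact hW j (by simp) ((W j).eq_top_of_nonempty_interior'
        (hne.mono (interior_maximal hsub hU)))
    obtain ⟨x, hx, hxs⟩ := ih (fun j hj => hW j (by simp [hj])) hopen hne'
    refine ⟨x, hx.1, fun i hi => ?_⟩
    rcases Finset.mem_insert.mp hi with rfl | hi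
    · exact hx.2
    · exact hxs i hi

/-- Any at most three members of the family are linearly independent. -/
def InGeneralPosition {ι E : Type*} [AddCommGroup E] [Module ℝ E] (v : ι → E)
    (V : Finset ι) : Prop :=
  ∀ s ⊆ V, s.card ≤ 3 → LinearIndepOn ℝ v (s : Set ι)

theorem InGeneralPosition.mono {ι E : Type*} [AddCommGroup E] [Module ℝ E] {v : ι → E}
    {V W : Finset ι} (h : InGeneralPosition v V) (hW : W ⊆ V) : InGeneralPosition v W :=
  fun s hs => h s (hs.trans hW)

/-- The vectors are chosen one at a time, each off the finitely many spans of at most two earlier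
ones. -/
theorem exists_inGeneralPosition {ι E : Type*} [NormedAddCommGroup E]
    [NormedSpace ℝ E] [FiniteDimensional ℝ E] (hE : Module.finrank ℝ E = 3)
    (U : ι → Set E) (hU : ∀ i, IsOpen (U i)) (hne : ∀ i, (U i).Nonempty) (V : Finset ι) :
    ∃ v : ι → E, (∀ i, v i ∈ U i) ∧ InGeneralPosition v V := by
  classical
  induction V using Finset.induction_on with
  | empty =>
    refine ⟨fun i => (hne i).some, fun i => (hne i).some_mem, fun s hs _ => ?_⟩
    rw [Finset.subset_empty.mp hs]
    simp
  | insert a V ha ih =>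
    obtain ⟨v, hv, hg⟩ := ih
    obtain ⟨x, hx, hxs⟩ := exists_mem_open_forall_notMem_submodule
      (V.powerset.filter (fun s => s.card ≤ 2))
      (fun s => Submodule.span ℝ (v '' (s : Set ι)))
      (by
        intro s hs htop
        have h1 : (s.image v).card ≤ 2 :=
          Finset.card_image_le.trans (Finset.mem_filter.mp hs).2
        have h2 := finrank_span_finset_le_card (R := ℝ) (s.image v)
        rw [Set.finrank, Finset.coe_image, htop, finrank_top, hE] at h2
        omega) (hU a) (hne a)
    have hEq : ∀ s : Finset ι, a ∉ s → Set.EqOn (Function.update v a x) v s := by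
      intro s hs i hi
      exact Function.update_of_ne (fun h => hs (by simpa [h] using hi)) _ _
    refine ⟨Function.update v a x, fun i => ?_, fun s hs hcard => ?_⟩
    · by_cases h : i = a
      · subst h; simpa using hx
      · simpa [h] using hv i
    · by_cases has : a ∈ s
      · obtain ⟨t, hat, rfl⟩ : ∃ t, a ∉ t ∧ s = insert a t :=
          ⟨s.erase a, by simp, (Finset.insert_erase has).symm⟩
        rw [Finset.card_insert_of_notMem hat] at hcard
        have htV : t ⊆ V := by
          intro i hi
          rcases Finset.mem_insert.mp (hs (Finset.mem_insert_of_mem hi)) with rfl | h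
          · exact absurd hi hat
          · exact h
        rw [Finset.coe_insert, linearIndepOn_insert (by simpa using hat)]
        refine ⟨(linearIndepOn_congr (hEq t hat)).mpr (hg t htV (by omega)), ?_⟩
        rw [(hEq t hat).image_eq, Function.update_self]
        exact hxs t (by simp [htV]; omega)
      · exact (linearIndepOn_congr (hEq s has)).mpr
          (hg s ((Finset.subset_insert_iff_of_notMem has).mp hs) hcard)

theorem InGeneralPosition.smul_sub_smul_ne_zero {ι E : Type*} [AddCommGroup E] [Module ℝ E]
    {v : ι → E} {V : Finset ι} (h : InGeneralPosition v V) {i j : ι} (hi : i ∈ V) (hj : j ∈ V)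
    (hij : i ≠ j) {α β : ℝ} (hα : α ≠ 0) : α • v j - β • v i ≠ 0 := by
  classical
  have hl := h {j, i} (by simp [Finset.insert_subset_iff, hi, hj]) (Finset.card_le_two.trans (by norm_num))
  rw [Finset.coe_pair, LinearIndepOn.pair_iff v hij.symm] at hl
  intro h0
  exact hα (hl α (-β) (by rw [neg_smul, ← sub_eq_add_neg, h0])).1

theorem InGeneralPosition.triple {ι E : Type*} [AddCommGroup E] [Module ℝ E]
    {v : ι → E} {V : Finset ι} (h : InGeneralPosition v V) {i j k : ι} (hi : i ∈ V) (hj : j ∈ V)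
    (hk : k ∈ V) (hij : i ≠ j) (hik : i ≠ k) (hjk : j ≠ k) :
    LinearIndependent ℝ ![v i, v j, v k] := by
  classical
  have hl := h {i, j, k} (by simp [Finset.insert_subset_iff, hi, hj, hk]) Finset.card_le_three
  have hinj : Function.Injective ![i, j, k] := by
    intro x y
    fin_cases x <;> fin_cases y <;> simp [hij, hik, hjk, hij.symm, hik.symm, hjk.symm]
  have := hl.comp (fun x : Fin 3 => ⟨![i, j, k] x, by fin_cases x <;> simp⟩)
    (fun x y hxy => hinj (congrArg Subtype.val hxy))
  convert this using 1
  ext x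
  fin_cases x <;> rfl

theorem exists_eq_smul_add_smul_add_smul {E : Type*} [AddCommGroup E] [Module ℝ E]
    [FiniteDimensional ℝ E] (hE : Module.finrank ℝ E = 3) {a b c : E}
    (h : LinearIndependent ℝ ![a, b, c]) (x : E) :
    ∃ α β γ : ℝ, x = α • a + β • b + γ • c := by
  have htop := h.span_eq_top_of_card_eq_finrank' (by simp [hE])
  have hx : x ∈ Submodule.span ℝ (Set.range ![a, b, c]) := htop ▸ Submodule.mem_top
  obtain ⟨f, hf⟩ := (Submodule.mem_span_range_iff_exists_fun ℝ).mp hx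
  exact ⟨f 0, f 1, f 2, by simpa [Fin.sum_univ_three] using hf.symm⟩

/-- In general position, a vector has nonzero coordinates with respect to three others. -/
theorem InGeneralPosition.exists_coordinates {ι E : Type*} [AddCommGroup E] [Module ℝ E]
    [FiniteDimensional ℝ E] (hE : Module.finrank ℝ E = 3)
    {v : ι → E} {V : Finset ι} (h : InGeneralPosition v V) {i j k x : ι} (hi : i ∈ V) (hj : j ∈ V)
    (hk : k ∈ V) (hx : x ∈ V) (hij : i ≠ j) (hik : i ≠ k) (hjk : j ≠ k)
    (hxi : x ≠ i) (hxj : x ≠ j) (hxk : x ≠ k) :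
    ∃ α β γ : ℝ, v x = α • v i + β • v j + γ • v k ∧ α ≠ 0 ∧ β ≠ 0 ∧ γ ≠ 0 := by
  obtain ⟨α, β, γ, e⟩ := exists_eq_smul_add_smul_add_smul hE (h.triple hi hj hk hij hik hjk) (v x)
  have key : ∀ {p q : ι} {s t : ℝ}, p ∈ V → q ∈ V → x ≠ p → x ≠ q → p ≠ q →
      v x ≠ s • v p + t • v q := by
    intro p q s t hp hq hxp hxq hpq e
    have hl := h.triple hx hp hq hxp hxq hpq
    have := Fintype.linearIndependent_iff.mp hl ![1, -s, -t]
      (by simp [Fin.sum_univ_three, e]) 0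
    simp at this
  refine ⟨α, β, γ, e, ?_, ?_, ?_⟩
  · rintro rfl
    exact key hj hk hxj hxk hjk (by simpa using e)
  · rintro rfl
    exact key hi hk hxi hxk hik (by simpa using e)
  · rintro rfl
    exact key hi hj hxi hxj hij (by simpa using e)

/-! ### Shrinking half-spaces -/

/-- The indices of `V` whose vectors lie in the open half-space `q > 0`. -/
noncomputable def positiveSet {ι E : Type*} [NormedAddCommGroup E] [NormedSpace ℝ E] (v : ι → E)
    (V : Finset ι) (q : E →L[ℝ] ℝ) : Finset ι :=
  V.filter (fun i => 0 < q (v i))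

section

variable {ι E : Type*} [NormedAddCommGroup E] [NormedSpace ℝ E] {v : ι → E} {V : Finset ι}

theorem mem_positiveSet {q : E →L[ℝ] ℝ} {i : ι} :
    i ∈ positiveSet v V q ↔ i ∈ V ∧ 0 < q (v i) := by
  simp [positiveSet]

theorem exists_positive_forall_ne_zero [FiniteDimensional ℝ E] {w : E →L[ℝ] ℝ}
    (hw : ∀ i ∈ V, 0 < w (v i)) (Z : Finset E) (hZ : ∀ z ∈ Z, z ≠ 0) :
    ∃ g : E →L[ℝ] ℝ, (∀ i ∈ V, 0 < g (v i)) ∧ ∀ z ∈ Z, g z ≠ 0 := by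
  have hopen : IsOpen {g : E →L[ℝ] ℝ | ∀ i ∈ V, 0 < g (v i)} := by
    have : {g : E →L[ℝ] ℝ | ∀ i ∈ V, 0 < g (v i)} = ⋂ i ∈ V, {g | 0 < g (v i)} := by
      ext; simp
    rw [this]
    exact isOpen_biInter_finset fun i _ => isOpen_lt continuous_const (by fun_prop)
  obtain ⟨g, hg, hgZ⟩ := exists_mem_open_forall_notMem_submodule Z
    (fun z => LinearMap.ker (ContinuousLinearMap.apply ℝ ℝ z).toLinearMap)
    (by
      intro z hz htop
      obtain ⟨f, hf⟩ := SeparatingDual.exists_ne_zero (R := ℝ) (hZ z hz)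
      have : f ∈ LinearMap.ker (ContinuousLinearMap.apply ℝ ℝ z).toLinearMap :=
        htop ▸ Submodule.mem_top
      exact hf (by simpa using this)) hopen ⟨w, hw⟩
  exact ⟨g, hg, fun z hz h0 => hgZ z hz (by simpa using h0)⟩

/-- Subtracting a growing multiple of some `g` positive on `V` makes vectors leave in the order of
the ratios `q / g` and lets none enter. A generic `g` has no ties, so exactly one leaves first. -/
theorem exists_positiveSet_eq_erase [FiniteDimensional ℝ E] [DecidableEq ι]
    (hV : InGeneralPosition v V)
    {w : E →L[ℝ] ℝ} (hw : ∀ i ∈ V, 0 < w (v i)) {q : E →L[ℝ] ℝ}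
    (hq : (positiveSet v V q).Nonempty) :
    ∃ q' : E →L[ℝ] ℝ, ∃ i ∈ positiveSet v V q,
      positiveSet v V q' = (positiveSet v V q).erase i := by
  classical
  obtain ⟨g, hg, hgZ⟩ := exists_positive_forall_ne_zero hw
    ((positiveSet v V q).offDiag.image (fun x => q (v x.1) • v x.2 - q (v x.2) • v x.1)) (by
      intro z hz
      obtain ⟨⟨i, j⟩, hij, rfl⟩ := Finset.mem_image.mp hz
      obtain ⟨hi, hj, hne⟩ := Finset.mem_offDiag.mp hij
      rw [mem_positiveSet] at hi hj
      exact hV.smul_sub_smul_ne_zero hi.1 hj.1 hne hi.2.ne')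
  obtain ⟨i, hi, hmin⟩ := Finset.exists_min_image _ (fun j => q (v j) / g (v j)) hq
  have hi' := mem_positiveSet.mp hi
  have hgi := hg i hi'.1
  refine ⟨q - (q (v i) / g (v i)) • g, i, hi, ?_⟩
  ext j
  have hr : 0 < q (v i) / g (v i) := div_pos hi'.2 hgi
  rw [Finset.mem_erase, mem_positiveSet, mem_positiveSet]
  simp only [sub_apply, smul_apply, smul_eq_mul, sub_pos]
  constructor
  · rintro ⟨hj, hlt⟩
    refine ⟨?_, hj, (mul_pos hr (hg j hj)).trans hlt⟩
    rintro rfl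
    rw [div_mul_cancel₀ _ hgi.ne'] at hlt
    exact hlt.false
  · rintro ⟨hne, hj, hqj⟩
    refine ⟨hj, ?_⟩
    have hgj := hg j hj
    have hjm : j ∈ positiveSet v V q := mem_positiveSet.mpr ⟨hj, hqj⟩
    have hle := hmin j hjm
    rw [← lt_div_iff₀ hgj]
    refine lt_of_le_of_ne hle fun heq => ?_
    refine hgZ _ (Finset.mem_image_of_mem _
      (Finset.mem_offDiag.mpr (⟨hi, hjm, hne.symm⟩ : (i, j).1 ∈ _ ∧ (i, j).2 ∈ _ ∧ _))) ?_
    rw [div_eq_div_iff hgi.ne' hgj.ne'] at heq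
    simp only [map_sub, map_smul, smul_eq_mul]
    linarith

theorem exists_positiveSet_subset_card_eq [FiniteDimensional ℝ E] (hV : InGeneralPosition v V)
    {w : E →L[ℝ] ℝ} (hw : ∀ i ∈ V, 0 < w (v i)) (q : E →L[ℝ] ℝ) {n : ℕ}
    (hn : n ≤ (positiveSet v V q).card) :
    ∃ q' : E →L[ℝ] ℝ, positiveSet v V q' ⊆ positiveSet v V q ∧
      (positiveSet v V q').card = n := by
  classical
  induction hn using Nat.decreasingInduction with
  | self => exact ⟨q, subset_rfl, rfl⟩
  | of_succ k hk ih =>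
    obtain ⟨q₁, hsub, hcard⟩ := ih
    obtain ⟨q₂, i, hi, he⟩ := exists_positiveSet_eq_erase hV hw
      (Finset.card_pos.mp (by omega : 0 < (positiveSet v V q₁).card))
    refine ⟨q₂, he ▸ (Finset.erase_subset _ _).trans hsub, ?_⟩
    rw [he, Finset.card_erase_of_mem hi, hcard, Nat.add_sub_cancel]

/-! ### Triangles of extreme vectors -/

/-- Two vectors in the half-space `q ≤ 0` cannot lie opposite to different vertices of a
triangle of extreme vectors in `q > 0`. -/
theorem false_of_opposite_of_opposite {a s c x y : E} {q g : E →L[ℝ] ℝ}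
    (hs : 0 < q s) (hc : 0 < q c) (hx : q x ≤ 0) (hy : q y ≤ 0)
    (hgc : 0 < g c) (hgs : g s ≤ 0) (hgx : g x ≤ 0) (hgy : g y ≤ 0)
    {α β γ α' β' γ' : ℝ} (hα : α < 0) (hγ : 0 < γ) (hα' : 0 < α') (hγ' : 0 < γ')
    (ex : x = α • a + β • s + γ • c) (ey : y = α' • a + β' • s + γ' • c) : False := by
  -- This combination eliminates `a`. Its left side is nonpositive under both `q` and `g`; the sign
  -- of the coefficient of `s` decides which of the two makes the right side positive.
  have key : ∀ f : E →L[ℝ] ℝ,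
      α' * f x - α * f y = (α' * β - α * β') * f s + (α' * γ - α * γ') * f c := by
    intro f
    rw [ex, ey]
    simp only [map_add, map_smul, smul_eq_mul]
    ring
  have hpos : 0 < α' * γ - α * γ' := by
    linarith [mul_pos hα' hγ, mul_neg_of_neg_of_pos hα hγ']
  rcases le_or_gt (α' * β - α * β') 0 with h | h
  · have h1 := key g
    have h2 := mul_pos hpos hgc
    have h3 := mul_nonneg_of_nonpos_of_nonpos h hgs
    have h4 := mul_nonpos_of_nonneg_of_nonpos hα'.le hgx
    have h5 := mul_nonneg_of_nonpos_of_nonpos hα.le hgy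
    linarith
  · have h1 := key q
    have h2 := mul_pos hpos hc
    have h3 := mul_pos h hs
    have h4 := mul_nonpos_of_nonneg_of_nonpos hα'.le hx
    have h5 := mul_nonneg_of_nonpos_of_nonpos hα.le hy
    linarith

/-- Exactly one coordinate of a vector outside a half-space, with respect to three extreme
vectors inside it, is negative. -/
theorem exactly_one_coordinate_neg {a s c x : E} {w q ga gs gc : E →L[ℝ] ℝ}
    (hwa : 0 < w a) (hws : 0 < w s) (hwc : 0 < w c) (hwx : 0 < w x)
    (hqa : 0 < q a) (hqs : 0 < q s) (hqc : 0 < q c) (hqx : q x ≤ 0)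
    (haa : 0 < ga a) (has : ga s ≤ 0) (hac : ga c ≤ 0) (hax : ga x ≤ 0)
    (hsa : gs a ≤ 0) (hss : 0 < gs s) (hsc : gs c ≤ 0) (hsx : gs x ≤ 0)
    (hca : gc a ≤ 0) (hcs : gc s ≤ 0) (hcc : 0 < gc c) (hcx : gc x ≤ 0)
    {α β γ : ℝ} (hα : α ≠ 0) (hβ : β ≠ 0) (hγ : γ ≠ 0) (e : x = α • a + β • s + γ • c) :
    (α < 0 ∧ 0 < β ∧ 0 < γ) ∨ (0 < α ∧ β < 0 ∧ 0 < γ) ∨ (0 < α ∧ 0 < β ∧ γ < 0) := by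
  have key : ∀ f : E →L[ℝ] ℝ, f x = α * f a + β * f s + γ * f c := by
    intro f
    rw [e]
    simp only [map_add, map_smul, smul_eq_mul]
  have kw := key w
  have kq := key q
  have ka := key ga
  have ks := key gs
  have kc := key gc
  -- Three negative signs contradict `w`, three positive ones contradict `q`, and a single positive
  -- sign contradicts the functional isolating that vertex.
  rcases lt_or_gt_of_ne hα with h1 | h1 <;> rcases lt_or_gt_of_ne hβ with h2 | h2 <;>
    rcases lt_or_gt_of_ne hγ with h3 | h3
  · nlinarith [mul_neg_of_neg_of_pos h1 hwa, mul_neg_of_neg_of_pos h2 hws,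
      mul_neg_of_neg_of_pos h3 hwc]
  · nlinarith [mul_nonneg_of_nonpos_of_nonpos h1.le hca, mul_nonneg_of_nonpos_of_nonpos h2.le hcs,
      mul_pos h3 hcc]
  · nlinarith [mul_nonneg_of_nonpos_of_nonpos h1.le hsa, mul_nonneg_of_nonpos_of_nonpos h3.le hsc,
      mul_pos h2 hss]
  · exact Or.inl ⟨h1, h2, h3⟩
  · nlinarith [mul_nonneg_of_nonpos_of_nonpos h2.le has, mul_nonneg_of_nonpos_of_nonpos h3.le hac,
      mul_pos h1 haa]
  · exact Or.inr (Or.inl ⟨h1, h2, h3⟩)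
  · exact Or.inr (Or.inr ⟨h1, h2, h3⟩)
  · nlinarith [mul_pos h1 hqa, mul_pos h2 hqs, mul_pos h3 hqc]

end

/-- Among three extreme vectors in a half-space, one is cut off by the other two: every
half-space containing it but neither of the other two is contained in the given one. -/
theorem exists_forall_nonpos_of_extreme {ι E : Type*} [NormedAddCommGroup E] [NormedSpace ℝ E]
    [FiniteDimensional ℝ E] (hE : Module.finrank ℝ E = 3) {v : ι → E} {V : Finset ι}
    (hV : InGeneralPosition v V) {w q : E →L[ℝ] ℝ} (hw : ∀ i ∈ V, 0 < w (v i)) {i j k : ι}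
    (hi : i ∈ positiveSet v V q) (hj : j ∈ positiveSet v V q) (hk : k ∈ positiveSet v V q)
    (hij : i ≠ j) (hik : i ≠ k) (hjk : j ≠ k)
    (hext : ∀ t, t = i ∨ t = j ∨ t = k → ∃ g : E →L[ℝ] ℝ, positiveSet v V g = {t}) :
    ∃ s, (s = i ∨ s = j ∨ s = k) ∧ ∀ x ∈ V, q (v x) ≤ 0 → ∀ g : E →L[ℝ] ℝ, 0 < g (v s) →
      (∀ t, t = i ∨ t = j ∨ t = k → t ≠ s → g (v t) ≤ 0) → g (v x) ≤ 0 := by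
  obtain ⟨gi, hgi⟩ := hext i (by simp)
  obtain ⟨gj, hgj⟩ := hext j (by simp)
  obtain ⟨gk, hgk⟩ := hext k (by simp)
  have pos : ∀ {g : E →L[ℝ] ℝ} {t : ι}, positiveSet v V g = {t} → 0 < g (v t) := by
    intro g t h
    exact (mem_positiveSet.mp (h ▸ Finset.mem_singleton_self t)).2
  have nonpos : ∀ {g : E →L[ℝ] ℝ} {t x : ι}, positiveSet v V g = {t} → x ∈ V → x ≠ t →
      g (v x) ≤ 0 := by
    intro g t x h hx hne
    by_contra! hlt
    exact hne (Finset.mem_singleton.mp (h ▸ mem_positiveSet.mpr ⟨hx, hlt⟩))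
  rw [mem_positiveSet] at hi hj hk
  obtain ⟨hiV, hiq⟩ := hi
  obtain ⟨hjV, hjq⟩ := hj
  obtain ⟨hkV, hkq⟩ := hk
  have ne : ∀ {x t : ι}, q (v x) ≤ 0 → 0 < q (v t) → x ≠ t := by
    rintro x t h1 h2 rfl
    exact absurd h1 h2.not_ge
  have type : ∀ x ∈ V, q (v x) ≤ 0 → ∃ α β γ : ℝ, v x = α • v i + β • v j + γ • v k ∧
      ((α < 0 ∧ 0 < β ∧ 0 < γ) ∨ (0 < α ∧ β < 0 ∧ 0 < γ) ∨ (0 < α ∧ 0 < β ∧ γ < 0)) := by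
    intro x hx hxq
    have hxi := ne hxq hiq
    have hxj := ne hxq hjq
    have hxk := ne hxq hkq
    obtain ⟨α, β, γ, e, hα, hβ, hγ⟩ :=
      hV.exists_coordinates hE hiV hjV hkV hx hij hik hjk hxi hxj hxk
    exact ⟨α, β, γ, e, exactly_one_coordinate_neg (hw i hiV) (hw j hjV) (hw k hkV) (hw x hx)
      hiq hjq hkq hxq
      (pos hgi) (nonpos hgi hjV hij.symm) (nonpos hgi hkV hik.symm) (nonpos hgi hx hxi)
      (nonpos hgj hiV hij) (pos hgj) (nonpos hgj hkV hjk.symm) (nonpos hgj hx hxj)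
      (nonpos hgk hiV hik) (nonpos hgk hjV hjk) (pos hgk) (nonpos hgk hx hxk) hα hβ hγ e⟩
  have concl : ∀ (s : ι) (a b : ι) (x : ι) (g : E →L[ℝ] ℝ) (α β γ : ℝ),
      v x = α • v a + β • v b + γ • v s → 0 < α → 0 < β → γ < 0 →
      0 < g (v s) → g (v a) ≤ 0 → g (v b) ≤ 0 → g (v x) ≤ 0 := by
    intro s a b x g α β γ e hα hβ hγ hs ha hb
    rw [e]
    simp only [map_add, map_smul, smul_eq_mul]
    have h1 := mul_nonpos_of_nonneg_of_nonpos hα.le ha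
    have h2 := mul_nonpos_of_nonneg_of_nonpos hβ.le hb
    have h3 := mul_neg_of_neg_of_pos hγ hs
    linarith
  have h12 : ∀ x ∈ V, q (v x) ≤ 0 → ∀ y ∈ V, q (v y) ≤ 0 → ∀ α β γ α' β' γ' : ℝ,
      v x = α • v i + β • v j + γ • v k → v y = α' • v i + β' • v j + γ' • v k →
      α < 0 → 0 < γ → 0 < α' → 0 < γ' → False :=
    fun x hx hxq y hy hyq α β γ α' β' γ' ex ey h1 h2 h3 h4 =>
      false_of_opposite_of_opposite hjq hkq hxq hyq (pos hgk) (nonpos hgk hjV hjk)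
        (nonpos hgk hx (ne hxq hkq)) (nonpos hgk hy (ne hyq hkq)) h1 h2 h3 h4 ex ey
  have h13 : ∀ x ∈ V, q (v x) ≤ 0 → ∀ y ∈ V, q (v y) ≤ 0 → ∀ α β γ α' β' γ' : ℝ,
      v x = α • v i + β • v j + γ • v k → v y = α' • v i + β' • v j + γ' • v k →
      α < 0 → 0 < β → 0 < α' → 0 < β' → False :=
    fun x hx hxq y hy hyq α β γ α' β' γ' ex ey h1 h2 h3 h4 =>
      false_of_opposite_of_opposite hkq hjq hxq hyq (pos hgj) (nonpos hgj hkV hjk.symm)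
        (nonpos hgj hx (ne hxq hjq)) (nonpos hgj hy (ne hyq hjq)) h1 h2 h3 h4
        (ex.trans (add_right_comm _ _ _)) (ey.trans (add_right_comm _ _ _))
  have h23 : ∀ x ∈ V, q (v x) ≤ 0 → ∀ y ∈ V, q (v y) ≤ 0 → ∀ α β γ α' β' γ' : ℝ,
      v x = α • v i + β • v j + γ • v k → v y = α' • v i + β' • v j + γ' • v k →
      β < 0 → 0 < α → 0 < β' → 0 < α' → False :=
    fun x hx hxq y hy hyq α β γ α' β' γ' ex ey h1 h2 h3 h4 =>
      false_of_opposite_of_opposite (a := v j) (s := v k) (c := v i) hkq hiq hxq hyq (pos hgi)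
        (nonpos hgi hkV hik.symm)
        (nonpos hgi hx (ne hxq hiq)) (nonpos hgi hy (ne hyq hiq)) h1 h2 h3 h4
        (ex.trans (by abel)) (ey.trans (by abel))
  -- By `h12`, `h13` and `h23`, all vectors outside `q` have their negative coordinate at the same
  -- vertex, so any one of them determines `s`.
  by_cases hne : ∃ y ∈ V, q (v y) ≤ 0
  · obtain ⟨y, hy, hyq⟩ := hne
    obtain ⟨α', β', γ', ey, ⟨a', b', c'⟩ | ⟨a', b', c'⟩ | ⟨a', b', c'⟩⟩ := type y hy hyq
    · refine ⟨i, by simp, fun x hx hxq g hg hgt => ?_⟩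
      obtain ⟨α, β, γ, ex, ⟨a, b, c⟩ | ⟨a, b, c⟩ | ⟨a, b, c⟩⟩ := type x hx hxq
      · exact concl i j k x g β γ α (ex.trans (by abel)) b c a hg
          (hgt j (by simp) hij.symm) (hgt k (by simp) hik.symm)
      · exact (h12 y hy hyq x hx hxq _ _ _ _ _ _ ey ex a' c' a c).elim
      · exact (h13 y hy hyq x hx hxq _ _ _ _ _ _ ey ex a' b' a b).elim
    · refine ⟨j, by simp, fun x hx hxq g hg hgt => ?_⟩
      obtain ⟨α, β, γ, ex, ⟨a, b, c⟩ | ⟨a, b, c⟩ | ⟨a, b, c⟩⟩ := type x hx hxq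
      · exact (h12 x hx hxq y hy hyq _ _ _ _ _ _ ex ey a c a' c').elim
      · exact concl j i k x g α γ β (ex.trans (by abel)) a c b hg
          (hgt i (by simp) hij) (hgt k (by simp) hjk.symm)
      · exact (h23 y hy hyq x hx hxq _ _ _ _ _ _ ey ex b' a' b a).elim
    · refine ⟨k, by simp, fun x hx hxq g hg hgt => ?_⟩
      obtain ⟨α, β, γ, ex, ⟨a, b, c⟩ | ⟨a, b, c⟩ | ⟨a, b, c⟩⟩ := type x hx hxq
      · exact (h13 x hx hxq y hy hyq _ _ _ _ _ _ ex ey a b a' b').elim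
      · exact (h23 x hx hxq y hy hyq _ _ _ _ _ _ ex ey b a b' a').elim
      · exact concl k i j x g α β γ ex a b c hg (hgt i (by simp) hik) (hgt j (by simp) hjk)
  · exact ⟨i, by simp, fun x hx hxq => (hne ⟨x, hx, hxq⟩).elim⟩

/-! ### Shallow hitting sets -/

/-- A hitting set for the sets of size at least `m` cut off by half-spaces, each of which
contains such a set meeting the hitting set in at most three elements. -/
def IsShallowHittingSet {ι E : Type*} [NormedAddCommGroup E] [NormedSpace ℝ E] (v : ι → E)
    (V S : Finset ι) (m : ℕ) : Prop :=
  S ⊆ V ∧ ∀ q : E →L[ℝ] ℝ, m ≤ (positiveSet v V q).card →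
    (∃ i ∈ S, 0 < q (v i)) ∧ ∃ q' : E →L[ℝ] ℝ, positiveSet v V q' ⊆ positiveSet v V q ∧
      m ≤ (positiveSet v V q').card ∧ (S.filter (fun i => 0 < q' (v i))).card ≤ 3

theorem exists_isShallowHittingSet_of_positive {ι E : Type*} [NormedAddCommGroup E]
    [NormedSpace ℝ E] [FiniteDimensional ℝ E] (hE : Module.finrank ℝ E = 3) {v : ι → E}
    {V : Finset ι} (hV : InGeneralPosition v V) {w : E →L[ℝ] ℝ} (hw : ∀ i ∈ V, 0 < w (v i))
    {m : ℕ} (hm : 1 ≤ m) : ∃ S, IsShallowHittingSet v V S m := by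
  classical
  let T := V.filter (fun i => ∃ g : E →L[ℝ] ℝ, positiveSet v V g = {i})
  let Hits : Finset ι → Prop := fun S =>
    ∀ q : E →L[ℝ] ℝ, m ≤ (positiveSet v V q).card → ∃ i ∈ S, 0 < q (v i)
  -- Shrinking a half-space to a single vector exhibits an extreme vector in it.
  have hT : Hits T := by
    intro q hq
    obtain ⟨g, hsub, hcard⟩ := exists_positiveSet_subset_card_eq hV hw q (hm.trans hq)
    obtain ⟨i, hi⟩ := Finset.card_eq_one.mp hcard
    have hiq := mem_positiveSet.mp (hsub (hi ▸ Finset.mem_singleton_self i))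
    exact ⟨i, Finset.mem_filter.mpr ⟨hiq.1, g, hi⟩, hiq.2⟩
  obtain ⟨S, hS, hmin⟩ := Finset.exists_min_image (T.powerset.filter Hits) Finset.card
    ⟨T, by simp [hT]⟩
  rw [Finset.mem_filter, Finset.mem_powerset] at hS
  obtain ⟨hST, hSH⟩ := hS
  -- Minimality: without `s`, some large half-space is no longer hit, so it is private to `s`.
  have priv : ∀ s ∈ S, ∃ g : E →L[ℝ] ℝ, m ≤ (positiveSet v V g).card ∧ 0 < g (v s) ∧
      ∀ t ∈ S, t ≠ s → g (v t) ≤ 0 := by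
    intro s hs
    have hnot : ¬ Hits (S.erase s) := by
      intro h
      have := hmin (S.erase s)
        (by simp [h, (Finset.erase_subset s S).trans hST])
      have := Finset.card_erase_lt_of_mem hs
      omega
    simp only [Hits, not_forall, not_exists, not_and, not_lt] at hnot
    obtain ⟨g, hg, hgn⟩ := hnot
    obtain ⟨i, hi, hig⟩ := hSH g hg
    have his : i = s := by
      by_contra hne
      exact absurd hig (hgn i (Finset.mem_erase.mpr ⟨hne, hi⟩)).not_gt
    exact ⟨g, hg, his ▸ hig, fun t ht hts => hgn t (Finset.mem_erase.mpr ⟨hts, ht⟩)⟩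
  refine ⟨S, hST.trans (Finset.filter_subset _ _), fun q hq => ⟨hSH q hq, ?_⟩⟩
  -- With exactly `m` vectors left, no private half-space can cut off a proper subset of them.
  obtain ⟨q', hsub, hcard⟩ := exists_positiveSet_subset_card_eq hV hw q hq
  refine ⟨q', hsub, hcard.ge, ?_⟩
  by_contra! hlt
  -- Three hits already give a contradiction; the bound three is there for the tetrahedron case.
  obtain ⟨i, j, k, hi, hj, hk, hij, hik, hjk⟩ := Finset.two_lt_card_iff.mp ((Nat.lt_succ_self 2).trans hlt)
  have mem : ∀ t, t = i ∨ t = j ∨ t = k → t ∈ S ∧ t ∈ positiveSet v V q' ∧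
      ∃ g : E →L[ℝ] ℝ, positiveSet v V g = {t} := by
    intro t ht
    have h1 : t ∈ S.filter (fun i => 0 < q' (v i)) := by
      rcases ht with rfl | rfl | rfl <;> assumption
    obtain ⟨h2, h3⟩ := Finset.mem_filter.mp h1
    obtain ⟨h4, h5⟩ := Finset.mem_filter.mp (hST h2)
    exact ⟨h2, mem_positiveSet.mpr ⟨h4, h3⟩, h5⟩
  obtain ⟨s, hs, hsx⟩ := exists_forall_nonpos_of_extreme hE hV hw (mem i (by simp)).2.1
    (mem j (by simp)).2.1 (mem k (by simp)).2.1 hij hik hjk (fun t ht => (mem t ht).2.2)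
  obtain ⟨g, hgm, hgs, hgt⟩ := priv s (mem s hs).1
  have hss : positiveSet v V g ⊂ positiveSet v V q' := by
    rw [Finset.ssubset_iff_of_subset]
    · obtain ⟨t, ht, hts⟩ : ∃ t, (t = i ∨ t = j ∨ t = k) ∧ t ≠ s := by
        rcases eq_or_ne i s with rfl | h
        · exact ⟨j, by simp, hij.symm⟩
        · exact ⟨i, by simp, h⟩
      exact ⟨t, (mem t ht).2.1, fun h =>
        absurd (mem_positiveSet.mp h).2 (hgt t (mem t ht).1 hts).not_gt⟩
    · intro x hx
      obtain ⟨hxV, hxg⟩ := mem_positiveSet.mp hx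
      refine mem_positiveSet.mpr ⟨hxV, ?_⟩
      by_contra! h
      exact absurd hxg
        (hsx x hxV h g hgs (fun t ht hts => hgt t (mem t ht).1 hts)).not_gt
  have := Finset.card_lt_card hss
  omega

/-- By Carathéodory and general position, 0 is a positive combination of exactly four of the
vectors. The values of a nonzero functional on them have weighted sum zero without all vanishing, so
between one and three are positive. -/
theorem exists_isShallowHittingSet_of_mem_convexHull {ι E : Type*} [NormedAddCommGroup E]
    [NormedSpace ℝ E] [FiniteDimensional ℝ E] (hE : Module.finrank ℝ E = 3) {v : ι → E}
    {V : Finset ι} (hV : InGeneralPosition v V) (h0 : (0 : E) ∈ convexHull ℝ (v '' V))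
    {m : ℕ} (hm : 1 ≤ m) : ∃ S, IsShallowHittingSet v V S m := by
  classical
  obtain ⟨κ, _, z, c, hz, hind, hc, hc1, hsum⟩ := eq_pos_convex_span_of_mem_convexHull h0
  choose f hfV hf using fun k => hz (Set.mem_range_self k)
  have hzinj : Function.Injective z := hind.injective
  have hfinj : Function.Injective f := fun a b hab => hzinj (by rw [← hf, ← hf, hab])
  have hcard : Fintype.card κ ≤ 4 := by
    have := hind.card_le_finrank_succ
    have := Submodule.finrank_le (vectorSpan ℝ (Set.range z))
    omega
  have hne : Nonempty κ := by
    by_contra hemp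
    rw [not_nonempty_iff] at hemp
    simp at hc1
  have hsum' : ∀ q : E →L[ℝ] ℝ, ∑ k, c k * q (v (f k)) = 0 := by
    intro q
    have := congrArg q hsum
    simpa [map_sum, hf] using this
  have hcard3 : ∀ s : Finset κ, s.card ≤ 3 → LinearIndepOn ℝ z (s : Set κ) := by
    intro s hs
    have h1 := hV (s.image f) (fun i hi => by obtain ⟨k, -, rfl⟩ := Finset.mem_image.mp hi; exact hfV k)
      (Finset.card_image_le.trans hs)
    rw [Finset.coe_image] at h1
    have h2 := h1.comp_of_image hfinj.injOn
    have : v ∘ f = z := funext hf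
    rwa [this] at h2
  -- Fewer than four would be linearly independent, against the relation `hsum`.
  have hcard4 : Fintype.card κ = 4 := by
    by_contra hne4
    have hli := hcard3 Finset.univ (by rw [Finset.card_univ]; omega)
    rw [Finset.coe_univ, linearIndepOn_univ_iff] at hli
    obtain ⟨k⟩ := hne
    exact (hc k).ne' (Fintype.linearIndependent_iff.mp hli c hsum k)
  have hspan : ∀ q : E →L[ℝ] ℝ, (∀ k, q (v (f k)) = 0) → q = 0 := by
    intro q hq
    obtain ⟨s, -, hs⟩ := Finset.exists_subset_card_eq
      (show 3 ≤ (Finset.univ : Finset κ).card by rw [Finset.card_univ]; omega)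
    have hli : LinearIndependent ℝ (fun k : s => z k) := hcard3 s hs.le
    have htop := hli.span_eq_top_of_card_eq_finrank' (by simp [hE, hs])
    ext x
    have hx : x ∈ Submodule.span ℝ (Set.range fun k : s => z k) := htop ▸ Submodule.mem_top
    have : Submodule.span ℝ (Set.range fun k : s => z k) ≤ LinearMap.ker q.toLinearMap := by
      rw [Submodule.span_le]
      rintro _ ⟨k, rfl⟩
      simpa [← hf] using hq k
    simpa using this hx
  refine ⟨Finset.univ.image f, ?_, fun q hq => ⟨?_, q, subset_rfl, hq, ?_⟩⟩
  · intro i hi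
    obtain ⟨k, -, rfl⟩ := Finset.mem_image.mp hi
    exact hfV k
  · by_contra! hcon
    have hnp : ∀ k, q (v (f k)) ≤ 0 := fun k => hcon _ (by simp)
    have hz0 := (Finset.sum_eq_zero_iff_of_nonpos
      (fun k _ => mul_nonpos_of_nonneg_of_nonpos (hc k).le (hnp k))).mp (hsum' q)
    have hq0 : q = 0 := hspan q fun k =>
      (mul_eq_zero.mp (hz0 k (Finset.mem_univ k))).resolve_left (hc k).ne'
    obtain ⟨i, hi⟩ := Finset.card_pos.mp (hm.trans hq)
    have := (mem_positiveSet.mp hi).2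
    simp [hq0] at this
  · have hlt : ((Finset.univ.image f).filter (fun i => 0 < q (v i))).card <
        (Finset.univ.image f).card := by
      refine Finset.card_lt_card (Finset.filter_ssubset.mpr ?_)
      by_contra! hcon
      have : 0 < ∑ k, c k * q (v (f k)) :=
        Finset.sum_pos (fun k _ => mul_pos (hc k) (hcon _ (by simp))) Finset.univ_nonempty
      exact this.ne' (hsum' q)
    have := Finset.card_image_le (s := Finset.univ) (f := f)
    rw [Finset.card_univ] at this
    omega

theorem exists_isShallowHittingSet {ι E : Type*} [NormedAddCommGroup E]
    [NormedSpace ℝ E] [FiniteDimensional ℝ E] (hE : Module.finrank ℝ E = 3) {v : ι → E}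
    {V : Finset ι} (hV : InGeneralPosition v V) {m : ℕ} (hm : 1 ≤ m) :
    ∃ S, IsShallowHittingSet v V S m := by
  by_cases h0 : (0 : E) ∈ convexHull ℝ (v '' V)
  · exact exists_isShallowHittingSet_of_mem_convexHull hE hV h0 hm
  · have hclosed : IsClosed (convexHull ℝ (v '' (V : Set ι))) :=
      ((V.finite_toSet.image v).isCompact_convexHull (𝕜 := ℝ)).isClosed
    obtain ⟨w, u, hu, hw⟩ :=
      geometric_hahn_banach_point_closed (convex_convexHull ℝ _) hclosed h0
    refine exists_isShallowHittingSet_of_positive hE hV (w := w) (fun i hi => ?_) hm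
    rw [map_zero] at hu
    exact hu.trans (hw _ (subset_convexHull ℝ _ (Set.mem_image_of_mem v hi)))

/-! ### Coloring by induction -/

theorem exists_polychromatic_coloring_halfSpaces {ι E : Type*} [NormedAddCommGroup E]
    [NormedSpace ℝ E] [FiniteDimensional ℝ E] (hE : Module.finrank ℝ E = 3) {v : ι → E}
    (k : ℕ) {V : Finset ι} (hV : InGeneralPosition v V) :
    ∃ χ : ι → Fin (k + 1), ∀ q : E →L[ℝ] ℝ, 3 * k + 1 ≤ (positiveSet v V q).card →
      ∀ c, ∃ i ∈ positiveSet v V q, χ i = c := by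
  classical
  induction k generalizing V with
  | zero =>
    refine ⟨fun _ => 0, fun q hq c => ?_⟩
    obtain ⟨i, hi⟩ := Finset.card_pos.mp (by omega : 0 < (positiveSet v V q).card)
    exact ⟨i, hi, Subsingleton.elim (α := Fin 1) _ _⟩
  | succ k ih =>
    obtain ⟨S, hSV, hS⟩ := exists_isShallowHittingSet hE hV (m := 3 * (k + 1) + 1) (by omega)
    obtain ⟨χ, hχ⟩ := ih (hV.mono (Finset.sdiff_subset (s := V) (t := S)))
    refine ⟨fun i => if i ∈ S then Fin.last _ else (χ i).castSucc, fun q hq c => ?_⟩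
    obtain ⟨⟨i, hi, hiq⟩, q', hsub, hcard, h3⟩ := hS q hq
    refine Fin.lastCases ?_ (fun c => ?_) c
    · exact ⟨i, mem_positiveSet.mpr ⟨hSV hi, hiq⟩, by simp [hi]⟩
    · have hle : positiveSet v V q' ⊆
          positiveSet v (V \ S) q' ∪ S.filter (fun i => 0 < q' (v i)) := by
        intro x hx
        rw [mem_positiveSet] at hx
        by_cases hxS : x ∈ S <;> simp [mem_positiveSet, hx, hxS]
      -- At most three of the `3 * (k + 1) + 1` vectors lie in `S`, which leaves the `3 * k + 1`
      -- that `hχ` needs.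
      have h4 := (Finset.card_le_card hle).trans (Finset.card_union_le _ _)
      obtain ⟨x, hx, hxc⟩ := hχ q' (by omega) c
      rw [mem_positiveSet, Finset.mem_sdiff] at hx
      exact ⟨x, hsub (mem_positiveSet.mpr ⟨hx.1.1, hx.2⟩), by simp [hx.1.2, hxc]⟩

/-! ### Duality with half-planes -/

/-- Evaluation at `p` of the affine function with gradient `x.1` and constant term `x.2`. -/
noncomputable def affineEval (p : Plane) : Plane × ℝ →L[ℝ] ℝ :=
  (innerSL ℝ p).coprod (ContinuousLinearMap.id ℝ ℝ)

theorem affineEval_apply (p a : Plane) (c : ℝ) : affineEval p (a, c) = inner ℝ a p + c := by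
  simp [affineEval, real_inner_comm]

/-- On finitely many points, a half-plane is cut out by an affine function without zeros. -/
theorem IsHalfPlane.exists_affineEval {R : Set Plane} (hR : IsHalfPlane R) (P : Finset Plane) :
    ∃ x : Plane × ℝ, ∀ p ∈ P, (p ∈ R → 0 < affineEval p x) ∧ (p ∉ R → affineEval p x < 0) := by
  obtain ⟨a, b, -, rfl | rfl⟩ := hR
  -- The threshold moves slightly down for a closed half-plane, up for an open one, so that no point
  -- of `P` stays on the boundary.
  · have h : ∀ᶠ t in nhdsWithin b (Set.Iio b), ∀ p ∈ P, inner ℝ a p < b → inner ℝ a p < t := by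
      rw [Filter.eventually_all_finset]
      intro p _
      by_cases hp : inner ℝ a p < b
      · exact ((eventually_gt_nhds hp).filter_mono nhdsWithin_le_nhds).mono fun t ht _ => ht
      · exact Filter.Eventually.of_forall fun t h => absurd h hp
    obtain ⟨t, ht, htb⟩ := (h.and self_mem_nhdsWithin).exists
    refine ⟨(a, -t), fun p hp => ?_⟩
    rw [affineEval_apply]
    have htb' : t < b := htb
    refine ⟨fun h => ?_, fun h => ?_⟩
    · have h' : b ≤ inner ℝ a p := h
      linarith
    · have := ht p hp (not_le.mp h)
      linarith
  · have h : ∀ᶠ t in nhdsWithin b (Set.Ioi b), ∀ p ∈ P, b < inner ℝ a p → t < inner ℝ a p := by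
      rw [Filter.eventually_all_finset]
      intro p _
      by_cases hp : b < inner ℝ a p
      · exact ((eventually_lt_nhds hp).filter_mono nhdsWithin_le_nhds).mono fun t ht _ => ht
      · exact Filter.Eventually.of_forall fun t h => absurd h hp
    obtain ⟨t, ht, htb⟩ := (h.and self_mem_nhdsWithin).exists
    refine ⟨(a, -t), fun p hp => ?_⟩
    rw [affineEval_apply]
    have htb' : b < t := htb
    refine ⟨fun h => ?_, fun h => ?_⟩
    · have := ht p hp h
      linarith
    · have h' : inner ℝ a p ≤ b := not_lt.mp h
      linarith

theorem isCoverThreshold_halfPlanes (k : ℕ) :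
    IsCoverThreshold halfPlanes (k + 1) (3 * k + 1) := by
  classical
  intro F hF
  -- With one point per covering pattern, only finitely many strict inequalities must survive the
  -- perturbation, so each `U R` below is open.
  obtain ⟨P, hP⟩ : ∃ P : Finset Plane, ∀ p, ∃ p' ∈ P, coveringAt F p' = coveringAt F p := by
    have hfin := Set.toFinite (Set.range (coveringAt F))
    refine ⟨hfin.toFinset.image (Function.invFun (coveringAt F)), fun p => ?_⟩
    exact ⟨_, Finset.mem_image_of_mem _ (by simp), Function.invFun_eq ⟨p, rfl⟩⟩
  let U : ↥F → Set (Plane × ℝ) := fun R => {x | ∀ p ∈ P,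
    (p ∈ (R : Set Plane) → 0 < affineEval p x) ∧ (p ∉ (R : Set Plane) → affineEval p x < 0)}
  have hU : ∀ R, IsOpen (U R) := by
    intro R
    have : U R = ⋂ p ∈ P, {x | (p ∈ (R : Set Plane) → 0 < affineEval p x) ∧
        (p ∉ (R : Set Plane) → affineEval p x < 0)} := by
      ext; simp [U]
    rw [this]
    refine isOpen_biInter_finset fun p _ => ?_
    by_cases hp : p ∈ (R : Set Plane)
    · simpa [hp] using isOpen_lt continuous_const (affineEval p).continuous
    · simpa [hp] using isOpen_lt (affineEval p).continuous continuous_const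
  obtain ⟨v, hv, hgen⟩ := exists_inGeneralPosition (E := Plane × ℝ) (by simp) U hU
    (fun R => (hF R.2 : IsHalfPlane _).exists_affineEval P) Finset.univ
  obtain ⟨χ, hχ⟩ := exists_polychromatic_coloring_halfSpaces (by simp) k hgen
  refine ⟨χ, fun p hp c => ?_⟩
  obtain ⟨p', hp', he⟩ := hP p
  have hpos : (positiveSet v Finset.univ (affineEval p') : Set ↥F) = coveringAt F p := by
    rw [← he]
    ext R
    simp only [Finset.mem_coe, mem_positiveSet, Finset.mem_univ, true_and, coveringAt,
      Set.mem_ofPred_eq]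
    refine ⟨fun h => ?_, (hv R p' hp').1⟩
    by_contra hn
    exact h.not_gt ((hv R p' hp').2 hn)
  rw [← hpos] at hp ⊢
  rw [Set.ncard_coe_finset] at hp
  obtain ⟨R, hR, hc⟩ := hχ _ hp c
  exact ⟨R, hR, hc⟩

theorem theorem3 (k : ℕ) (hk : 1 ≤ k) :
    fBar halfPlanes k ≤ ((3 * k - 2 : ℕ) : ℕ∞) := by
  obtain ⟨k, rfl⟩ := Nat.exists_eq_add_of_le' hk
  rw [fBar_le_iff, show 3 * (k + 1) - 2 = 3 * k + 1 by omega]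
  exact isCoverThreshold_halfPlanes k
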